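/- Model. A non-uniform QPT machine is a family $\{\mathcal A_\lambda\}_{\lambda\in\mathbb N}$: $\mathcal A_\lambda$ holds a pure advice state $|\alpha_\lambda\rangle$, applies a quantum circuit over the gate set $\{H,T,\mathrm{CNOT}\}$ to its input and its advice, and measures designated output qubits in the computational basis; the number of advice qubits plus the number of gates is bounded by a polynomial in $\lambda$. A function is negligible if it decays faster than every inverse polynomial in $\lambda$. Let $(\mathsf{SGen},\mathsf{Sign},\mathsf{Ver})$ be a one-time signature scheme, consisting of (possibly randomized) algorithms $(\mathsf{vk},\mathsf{sk})\gets\mathsf{SGen}(1^\lambda)$, $\sigma\gets\mathsf{Sign}(\mathsf{sk},m)$ and $\mathsf{Ver}(\mathsf{vk},m,\sigma)\in\{0,1\}$, where, for each $\lambda$, the keys, messages and signatures are bit strings of fixed lengths that are polynomially bounded in $\lambda$ (nothing else about the running time of the three algorithms is needed; in particular, polynomial-time algorithms are covered). Assume that the scheme is * correct: for all $\lambda$ and all messages $m$, $\Pr[\mathsf{Ver}(\mathsf{vk},m,\mathsf{Sign}(\mathsf{sk},m))=1 : (\mathsf{vk},\mathsf{sk})\gets\mathsf{SGen}(1^\lambda)]=1$;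 and * strongly existentially unforgeable: for every QPT $\{\mathcal A_\lambda\}$ there is a negligible function $\nu$ such that for all $\lambda$ and all messages $m$, $$\Pr\left[\mathsf{Ver}(\mathsf{vk},m^*,\sigma^*)=1\text{ and }(m^*,\sigma^*)\neq(m,\sigma) : \begin{array}{l}(\mathsf{vk},\mathsf{sk})\gets\mathsf{SGen}(1^\lambda);\\ \sigma\gets\mathsf{Sign}(\mathsf{sk},m);\\ (m^*,\sigma^*)\gets\mathcal A_\lambda(\mathsf{vk},m,\sigma)\end{array}\right]\le\nu(\lambda).$$ For each $\lambda$, fix two distinct messages standing for the bits $0$ and $1$. Then the ensembles $$\left\{\frac{|0,\sigma_0\rangle+|1,\sigma_1\rangle}{\sqrt2}\,\frac{\langle 0,\sigma_0|+\langle 1,\sigma_1|}{\sqrt2},\ (\mathsf{vk}_0,\mathsf{vk}_1)\right\}_\lambda\quad\text{and}\quad\left\{\frac{|0,\sigma_0\rangle\langle 0,\sigma_0|+|1,\sigma_1\rangle\langle 1,\sigma_1|}{2},\ (\mathsf{vk}_0,\mathsf{vk}_1)\right\}_\lambda,$$ where $(\mathsf{vk}_b,\mathsf{sk}_b)\gets\mathsf{SGen}(1^\lambda)$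 and $\sigma_b\gets\mathsf{Sign}(\mathsf{sk}_b,b)$ independently for $b\in\{0,1\}$, are computationally indistinguishable: for every QPT $\{\mathcal A_\lambda\}$ with one output bit, the absolute difference of the probabilities that $\mathcal A_\lambda$ outputs $1$ on the two ensembles is a negligible function of $\lambda$. -/

import Mathlib

namespace QOTS

/-! ### Bit strings, qubits and states -/

/-- Bit strings of length `n`. -/
abbrev BitStr (n : ℕ) : Type := Fin n → Bool

/-- Operators on the qubits labelled by `Q`, written in the computational basis `Q → Bool`. -/
abbrev Op (Q : Type) : Type := Matrix (Q → Bool) (Q → Bool) ℂ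

section Quantum

variable {Q R : Type} [Fintype Q] [DecidableEq Q] [Fintype R] [DecidableEq R]

/-- The computational basis vector `|x⟩`. -/
def ket (x : Q → Bool) : (Q → Bool) → ℂ := Pi.single x 1

/-- The rank-one operator `|ψ⟩⟨ψ|`. -/
def proj (ψ : (Q → Bool) → ℂ) : Op Q := Matrix.vecMulVec ψ (star ψ)

/-- The tensor product of an operator on the qubits `Q` and an operator on the qubits `R`. -/
def tensor (ρ : Op Q) (τ : Op R) : Op (Q ⊕ R) :=
  Matrix.of fun y x =>
    ρ (fun i => y (Sum.inl i)) (fun i => x (Sum.inl i)) *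
      τ (fun j => y (Sum.inr j)) (fun j => x (Sum.inr j))

/-! ### Quantum circuits over the universal gate set `{H, T, CNOT}` -/

/-- Elementary gates on the qubits `Q`; `CNOT c t` has control `c` and target `t`. -/
inductive Gate (Q : Type) : Type
  | H (i : Q)
  | T (i : Q)
  | CNOT (c t : Q) (h : c ≠ t)

/-- The one-qubit operator `u`, applied to qubit `i`. -/
noncomputable def onQubit (i : Q) (u : Matrix Bool Bool ℂ) : Op Q :=
  Matrix.of fun y x => if ∀ j, j ≠ i → y j = x j then u (y i) (x i) else 0

/-- The unitary of a gate (entry `y x` is `⟨y| U |x⟩`). -/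
noncomputable def Gate.unitary : Gate Q → Op Q
  | .H i => onQubit i
      (Matrix.of fun b a => ((1 / Real.sqrt 2 : ℝ) : ℂ) * (if a && b then -1 else 1))
  | .T i => onQubit i
      (Matrix.diagonal fun a => if a then Complex.exp (Real.pi / 4 * Complex.I) else 1)
  | .CNOT c t _ =>
      Matrix.of fun y x => if y = Function.update x t (xor (x t) (x c)) then 1 else 0

/-- A circuit is a list of gates; the head of the list is applied first. -/
abbrev Circuit (Q : Type) : Type := List (Gate Q)

/-- The unitary computed by a circuit. -/
noncomputable def circuitUnitary : Circuit Q → Op Q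
  | [] => 1
  | g :: c => circuitUnitary c * g.unitary

end Quantum

/-! ### Non-uniform quantum polynomial-time machines -/

/-- A quantum machine with input qubits `I` and output bits `O`: it holds an advice state on
`anc` further qubits, runs a circuit on input and advice, and measures the qubits `out` in the
computational basis. -/
structure QMachine (I O : Type) where
  anc : ℕ
  advice : BitStr anc → ℂ
  advice_unit : ∑ a, ‖advice a‖ ^ 2 = 1
  circuit : Circuit (I ⊕ Fin anc)
  out : O ↪ I ⊕ Fin anc

namespace QMachine

variable {I O : Type} [Fintype I] [DecidableEq I] [Fintype O] [DecidableEq O]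

/-- Size of a machine: number of advice qubits plus number of gates. -/
def size (A : QMachine I O) : ℕ := A.anc + A.circuit.length

/-- The state of the machine just before the measurement, on the input state `ρ`. -/
noncomputable def finalState (A : QMachine I O) (ρ : Op I) : Op (I ⊕ Fin A.anc) :=
  circuitUnitary A.circuit * tensor ρ (proj A.advice) * (circuitUnitary A.circuit).conjTranspose

/-- The projector onto the outcome `y` of the measurement of the output qubits. -/
def outcome (A : QMachine I O) (y : O → Bool) : Op (I ⊕ Fin A.anc) :=
  Matrix.diagonal fun x => if (fun o => x (A.out o)) = y then 1 else 0

/-- The probability that the machine outputs `y` on the input state `ρ`. -/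
noncomputable def outProb (A : QMachine I O) (ρ : Op I) (y : O → Bool) : ℝ :=
  (Matrix.trace (A.outcome y * A.finalState ρ)).re

end QMachine

/-- A family of quantum machines, indexed by the security parameter, is QPT if its size is
bounded by a polynomial. -/
def IsQPT {I O : ℕ → Type} (A : ∀ n, QMachine (I n) (O n)) : Prop :=
  ∃ p : Polynomial ℕ, ∀ n, (A n).size ≤ p.eval n

/-- Negligible functions: they decay faster than every inverse polynomial. -/
def Negligible (f : ℕ → ℝ) : Prop :=
  Asymptotics.SuperpolynomialDecay Filter.atTop (fun n : ℕ => (n : ℝ)) f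

/-- Computational indistinguishability of two ensembles of (density operators of) quantum
states: every QPT machine with one output bit has negligible distinguishing advantage. -/
def CompIndist {Q : ℕ → Type} [∀ n, Fintype (Q n)] [∀ n, DecidableEq (Q n)]
    (ρ τ : ∀ n, Op (Q n)) : Prop :=
  ∀ A : ∀ n, QMachine (Q n) Unit, IsQPT (I := Q) (O := fun _ => Unit) A →
    Negligible fun n =>
      |(A n).outProb (ρ n) (fun _ => true) - (A n).outProb (τ n) (fun _ => true)|

/-! ### One-time signatures -/

/-- A one-time signature scheme; `n` is the security parameter. The three algorithms may be
randomized; keys, messages and signatures are bit strings of polynomial length. The algorithms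
themselves are arbitrary: in particular, polynomial-time ones are covered. -/
structure OTS where
  vkLen : ℕ → ℕ
  skLen : ℕ → ℕ
  msgLen : ℕ → ℕ
  sigLen : ℕ → ℕ
  poly_len : ∃ p : Polynomial ℕ, ∀ n, vkLen n + skLen n + msgLen n + sigLen n ≤ p.eval n
  gen : ∀ n, PMF (BitStr (vkLen n) × BitStr (skLen n))
  sign : ∀ n, BitStr (skLen n) → BitStr (msgLen n) → PMF (BitStr (sigLen n))
  ver : ∀ n, BitStr (vkLen n) → BitStr (msgLen n) → BitStr (sigLen n) → PMF Bool

namespace OTS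

variable (S : OTS)

/-- Honest signatures are accepted with probability one. -/
def Correct : Prop :=
  ∀ n (m : BitStr (S.msgLen n)),
    ((S.gen n).bind fun k => (S.sign n k.2 m).bind fun σ => S.ver n k.1 m σ) true = 1

/-- The joint distribution of `(vk, σ)` for `(vk, sk) ← gen`, `σ ← sign sk m`. -/
noncomputable def signed (n : ℕ) (m : BitStr (S.msgLen n)) :
    PMF (BitStr (S.vkLen n) × BitStr (S.sigLen n)) :=
  (S.gen n).bind fun k => (S.sign n k.2 m).map fun σ => (k.1, σ)

/-- Input register `(vk, m, σ)` of a forger. -/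
abbrev ForgeIn (n : ℕ) : Type := Fin (S.vkLen n) ⊕ (Fin (S.msgLen n) ⊕ Fin (S.sigLen n))

/-- Output register `(m*, σ*)` of a forger. -/
abbrev ForgeOut (n : ℕ) : Type := Fin (S.msgLen n) ⊕ Fin (S.sigLen n)

/-- The probability that the forger `A`, on input `(vk, m, σ)`, outputs `(m*, σ*) ≠ (m, σ)`
with `ver vk m* σ* = 1`. -/
noncomputable def forgeProb (n : ℕ) (A : QMachine (S.ForgeIn n) (S.ForgeOut n))
    (m : BitStr (S.msgLen n)) : ℝ :=
  ∑ k : BitStr (S.vkLen n) × BitStr (S.sigLen n), (S.signed n m k).toReal *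
    ∑ f : BitStr (S.msgLen n) × BitStr (S.sigLen n),
      if f = (m, k.2) then 0 else
        A.outProb (proj (ket (Sum.elim k.1 (Sum.elim m k.2)))) (Sum.elim f.1 f.2) *
          (S.ver n k.1 f.1 f.2 true).toReal

/-- (Quantum-secure) strong existential unforgeability. -/
def StronglyUnforgeable : Prop :=
  ∀ A : ∀ n, QMachine (S.ForgeIn n) (S.ForgeOut n), IsQPT (I := S.ForgeIn) (O := S.ForgeOut) A →
    ∃ ν : ℕ → ℝ, Negligible ν ∧ ∀ n (m : BitStr (S.msgLen n)), S.forgeProb n (A n) m ≤ ν n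

/-! ### Signature states -/

/-- The quantum register, holding a bit and a signature. -/
abbrev SigReg (n : ℕ) : Type := Unit ⊕ Fin (S.sigLen n)

/-- The register holding the two verification keys. -/
abbrev KeyReg (n : ℕ) : Type := Fin (S.vkLen n) ⊕ Fin (S.vkLen n)

variable {S} in
/-- The basis state `|b, σ⟩`. -/
def sigKet {n : ℕ} (b : Bool) (σ : BitStr (S.sigLen n)) : (S.SigReg n → Bool) → ℂ :=
  ket (Sum.elim (fun _ => b) σ)

/-- The state of `(ρ(σ₀, σ₁), (vk₀, vk₁))` averaged over independent
`(vk_b, sk_b) ← gen`, `σ_b ← sign sk_b b`; here `bit b` is the message that stands for `b`. -/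
noncomputable def ensemble (bit : ∀ n, Bool ↪ BitStr (S.msgLen n))
    (ρ : ∀ n, BitStr (S.sigLen n) → BitStr (S.sigLen n) → Op (S.SigReg n)) (n : ℕ) :
    Op (S.SigReg n ⊕ S.KeyReg n) :=
  ∑ k₀ : BitStr (S.vkLen n) × BitStr (S.sigLen n),
    ∑ k₁ : BitStr (S.vkLen n) × BitStr (S.sigLen n),
      (((S.signed n (bit n false) k₀).toReal * (S.signed n (bit n true) k₁).toReal : ℝ) : ℂ) •
        tensor (ρ n k₀.2 k₁.2) (proj (ket (Sum.elim k₀.1 k₁.1)))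

/-- The projector onto `(|0, σ₀⟩ + |1, σ₁⟩) / √2`. -/
noncomputable def superposition (n : ℕ) (σ₀ σ₁ : BitStr (S.sigLen n)) : Op (S.SigReg n) :=
  proj (((1 / Real.sqrt 2 : ℝ) : ℂ) • (sigKet false σ₀ + sigKet true σ₁))

/-- The mixture `(|0, σ₀⟩⟨0, σ₀| + |1, σ₁⟩⟨1, σ₁|) / 2`. -/
noncomputable def mixture (n : ℕ) (σ₀ σ₁ : BitStr (S.sigLen n)) : Op (S.SigReg n) :=
  (1 / 2 : ℂ) • (proj (sigKet false σ₀) + proj (sigKet true σ₁))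

end OTS

end QOTS

/-!
The two ensembles differ only in the off-diagonal terms of `|0, σ₀⟩ + |1, σ₁⟩`, so the advantage of
a distinguisher with unitary `U` and accepting projector `Π` is the average of
`re ⟨1, σ₁| U† Π U |0, σ₀⟩`. The reflection `U† (1 - 2 Π) U` is again efficient, and since
`|0, σ₀⟩` and `|1, σ₁⟩` are orthogonal, the square of twice this number bounds the probability that
it turns `|0, σ₀⟩` into `|1, σ₁⟩`. With the best pair `(vk₀, σ₀)` as advice, the reflection
therefore forges a signature on the message that stands for `1` from `vk₁` alone, and by Jensen's
inequality it succeeds with probability at least the square of the advantage.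
-/

open scoped Matrix

namespace QOTS

/-! ### Inverting circuits -/

section Gates

variable {Q : Type} [Fintype Q] [DecidableEq Q]

theorem onQubit_mulVec_apply (i : Q) (u : Matrix Bool Bool ℂ) (ψ : (Q → Bool) → ℂ) (y : Q → Bool) :
    (onQubit i u *ᵥ ψ) y = ∑ b, u (y i) b * ψ (Function.update y i b) := by
  symm
  refine Fintype.sum_of_injective (Function.update y i) (Function.update_injective y i) _ _
    (fun x hx => ?_) fun b => ?_
  · have hne : ¬ ∀ j, j ≠ i → y j = x j := fun h =>
      hx ⟨x i, (Function.eq_update_iff.2 ⟨rfl, fun j hj => (h j hj).symm⟩).symm⟩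
    simp only [onQubit, Matrix.of_apply, if_neg hne, zero_mul]
  · have heq : ∀ j, j ≠ i → y j = Function.update y i b j := fun j hj =>
      (Function.update_of_ne hj b y).symm
    simp only [onQubit, Matrix.of_apply, if_pos heq, Function.update_self]

theorem onQubit_mul (i : Q) (u v : Matrix Bool Bool ℂ) :
    onQubit i u * onQubit i v = onQubit i (u * v) := by
  apply Matrix.mulVec_injective
  funext ψ y
  simp only [← Matrix.mulVec_mulVec, onQubit_mulVec_apply, Matrix.mul_apply, Function.update_self,
    Function.update_idem, Finset.mul_sum, Finset.sum_mul]
  rw [Finset.sum_comm]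
  simp only [mul_assoc]

theorem onQubit_diagonal (i : Q) (d : Bool → ℂ) :
    onQubit i (Matrix.diagonal d) = Matrix.diagonal fun x => d (x i) := by
  apply Matrix.mulVec_injective
  funext ψ y
  simp [onQubit_mulVec_apply, Matrix.mulVec_diagonal, Matrix.diagonal_apply]

theorem onQubit_one (i : Q) : onQubit i 1 = 1 := by
  simpa only [Matrix.diagonal_one] using onQubit_diagonal i fun _ => 1

theorem conjTranspose_onQubit (i : Q) (u : Matrix Bool Bool ℂ) :
    (onQubit i u)ᴴ = onQubit i uᴴ := by
  ext y x
  simp only [Matrix.conjTranspose_apply, onQubit, Matrix.of_apply, eq_comm (a := y _),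
    apply_ite star, star_zero]

theorem conjTranspose_unitary_H (i : Q) : (Gate.H i).unitaryᴴ = (Gate.H i).unitary := by
  rw [Gate.unitary, conjTranspose_onQubit]
  congr 1
  ext b a
  cases a <;> cases b <;> simp

theorem unitary_H_mul_self (i : Q) : (Gate.H i).unitary * (Gate.H i).unitary = 1 := by
  have hsq : ((Real.sqrt 2 : ℝ) : ℂ)⁻¹ * ((Real.sqrt 2 : ℝ) : ℂ)⁻¹ = 1 / 2 := by
    rw [← mul_inv, ← Complex.ofReal_mul, Real.mul_self_sqrt (by norm_num)]
    norm_num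
  rw [Gate.unitary, onQubit_mul, ← onQubit_one i]
  congr 1
  ext b a
  cases a <;> cases b <;> norm_num [Matrix.mul_apply, hsq]

theorem unitary_T (i : Q) :
    (Gate.T i).unitary =
      Matrix.diagonal fun x => if x i then Complex.exp (Real.pi / 4 * Complex.I) else 1 :=
  onQubit_diagonal i _

theorem conjTranspose_unitary_T_mul_self (i : Q) :
    (Gate.T i).unitaryᴴ * (Gate.T i).unitary = 1 := by
  have hphase : (starRingEnd ℂ) (Complex.exp (Real.pi / 4 * Complex.I)) *
      Complex.exp (Real.pi / 4 * Complex.I) = 1 := by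
    rw [← Complex.exp_conj, ← Complex.exp_add]
    simp [map_ofNat]
  rw [unitary_T, Matrix.diagonal_conjTranspose, Matrix.diagonal_mul_diagonal,
    Matrix.diagonal_eq_one]
  funext x
  cases hx : x i <;> simp [hx, hphase]

theorem unitary_T_pow_four (i : Q) :
    (Gate.T i).unitary ^ 4 = Matrix.diagonal fun x => if x i then -1 else 1 := by
  have hphase : Complex.exp (Real.pi / 4 * Complex.I) ^ 4 = -1 := by
    rw [← Complex.exp_nat_mul, ← Complex.exp_pi_mul_I]
    congr 1
    push_cast
    ring
  rw [unitary_T, Matrix.diagonal_pow]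
  congr 1
  funext x
  cases hx : x i <;> simp [hx, hphase]

theorem unitary_T_pow_eight (i : Q) : (Gate.T i).unitary ^ 8 = 1 := by
  rw [show 8 = 4 + 4 from rfl, pow_add, unitary_T_pow_four, Matrix.diagonal_mul_diagonal,
    Matrix.diagonal_eq_one]
  funext x
  cases x i <;> simp

theorem conjTranspose_unitary_T (i : Q) : (Gate.T i).unitaryᴴ = (Gate.T i).unitary ^ 7 := by
  calc (Gate.T i).unitaryᴴ = (Gate.T i).unitaryᴴ * (Gate.T i).unitary ^ 8 := by
        rw [unitary_T_pow_eight, mul_one]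
    _ = (Gate.T i).unitary ^ 7 := by
        rw [pow_succ' _ 7, ← mul_assoc, conjTranspose_unitary_T_mul_self, one_mul]

omit [Fintype Q] in
theorem involutive_cnot {c t : Q} (h : c ≠ t) :
    Function.Involutive fun x : Q → Bool => Function.update x t (xor (x t) (x c)) := fun x => by
  simp [h]

theorem conjTranspose_unitary_CNOT {c t : Q} (h : c ≠ t) :
    (Gate.CNOT c t h).unitaryᴴ = (Gate.CNOT c t h).unitary := by
  ext y x
  simp only [Matrix.conjTranspose_apply, Gate.unitary, Matrix.of_apply, apply_ite star, star_one,
    star_zero, eq_comm (a := x), (involutive_cnot h).eq_iff]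

theorem unitary_CNOT_mul_self {c t : Q} (h : c ≠ t) :
    (Gate.CNOT c t h).unitary * (Gate.CNOT c t h).unitary = 1 := by
  have hinv := involutive_cnot h
  ext y x
  simp only [Matrix.mul_apply, Gate.unitary, Matrix.of_apply, mul_ite, mul_one, mul_zero,
    Finset.sum_ite_eq', Finset.mem_univ, if_true, hinv x, Matrix.one_apply]

theorem Gate.unitary_mem_unitaryGroup (g : Gate Q) :
    g.unitary ∈ Matrix.unitaryGroup (Q → Bool) ℂ := by
  rw [Matrix.mem_unitaryGroup_iff', Matrix.star_eq_conjTranspose]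
  cases g with
  | H i => rw [conjTranspose_unitary_H, unitary_H_mul_self]
  | T i => exact conjTranspose_unitary_T_mul_self i
  | CNOT c t h => rw [conjTranspose_unitary_CNOT, unitary_CNOT_mul_self]

theorem circuitUnitary_mem_unitaryGroup (c : Circuit Q) :
    circuitUnitary c ∈ Matrix.unitaryGroup (Q → Bool) ℂ := by
  induction c with
  | nil => exact one_mem _
  | cons g c ih => exact mul_mem ih g.unitary_mem_unitaryGroup

theorem circuitUnitary_append (c d : Circuit Q) :
    circuitUnitary (c ++ d) = circuitUnitary d * circuitUnitary c := by
  induction c with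
  | nil => simp [circuitUnitary]
  | cons g c ih => simp [circuitUnitary, ih, mul_assoc]

theorem circuitUnitary_replicate (g : Gate Q) (k : ℕ) :
    circuitUnitary (List.replicate k g) = g.unitary ^ k := by
  induction k with
  | zero => rfl
  | succ k ih => rw [List.replicate_succ, circuitUnitary, ih, pow_succ]

end Gates

section InverseCircuit

variable {Q : Type}

/-- A circuit over the same gate set for the inverse of a gate; it uses `T⁻¹ = T⁷`. -/
def Gate.inverse : Gate Q → Circuit Q
  | .H i => [.H i]
  | .T i => List.replicate 7 (.T i)
  | .CNOT c t h => [.CNOT c t h]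

/-- A circuit over the same gate set for the inverse of a circuit. -/
def inverseCircuit : Circuit Q → Circuit Q
  | [] => []
  | g :: c => inverseCircuit c ++ g.inverse

theorem Gate.length_inverse_le (g : Gate Q) : g.inverse.length ≤ 7 := by
  cases g <;> simp [Gate.inverse]

theorem length_inverseCircuit_le (c : Circuit Q) : (inverseCircuit c).length ≤ 7 * c.length := by
  induction c with
  | nil => rfl
  | cons g c ih =>
    have := g.length_inverse_le
    simp only [inverseCircuit, List.length_append, List.length_cons]
    omega

variable [Fintype Q] [DecidableEq Q]

theorem Gate.circuitUnitary_inverse (g : Gate Q) : circuitUnitary g.inverse = g.unitaryᴴ := by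
  cases g with
  | H i => rw [conjTranspose_unitary_H, Gate.inverse, circuitUnitary, circuitUnitary, one_mul]
  | T i => rw [conjTranspose_unitary_T, Gate.inverse, circuitUnitary_replicate]
  | CNOT c t h =>
    rw [conjTranspose_unitary_CNOT, Gate.inverse, circuitUnitary, circuitUnitary, one_mul]

theorem circuitUnitary_inverseCircuit (c : Circuit Q) :
    circuitUnitary (inverseCircuit c) = (circuitUnitary c)ᴴ := by
  induction c with
  | nil => simp [circuitUnitary, inverseCircuit]
  | cons g c ih =>
    rw [inverseCircuit, circuitUnitary_append, ih, Gate.circuitUnitary_inverse, circuitUnitary,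
      Matrix.conjTranspose_mul]

end InverseCircuit

/-! ### Relabelled and idle qubits -/

section Tensor

variable {Q R : Type}

theorem tensor_eq_submatrix_kronecker (ρ : Op Q) (τ : Op R) :
    tensor ρ τ = (ρ.kronecker τ).submatrix (Equiv.sumArrowEquivProdArrow Q R Bool)
      (Equiv.sumArrowEquivProdArrow Q R Bool) :=
  rfl

theorem tensor_smul_left (c : ℂ) (ρ : Op Q) (τ : Op R) : tensor (c • ρ) τ = c • tensor ρ τ := by
  ext y x
  simp [tensor, mul_assoc]

theorem tensor_add_left (ρ ρ' : Op Q) (τ : Op R) :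
    tensor (ρ + ρ') τ = tensor ρ τ + tensor ρ' τ := by
  ext y x
  simp [tensor, add_mul]

theorem conjTranspose_tensor (ρ : Op Q) (τ : Op R) : (tensor ρ τ)ᴴ = tensor ρᴴ τᴴ := by
  ext y x
  simp [tensor]

/-- The tensor product of state vectors. -/
def tensorVec (v : (Q → Bool) → ℂ) (w : (R → Bool) → ℂ) : (Q ⊕ R → Bool) → ℂ :=
  fun x => v (fun i => x (Sum.inl i)) * w (fun j => x (Sum.inr j))

theorem tensorVec_smul_left (c : ℂ) (v : (Q → Bool) → ℂ) (w : (R → Bool) → ℂ) :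
    tensorVec (c • v) w = c • tensorVec v w := by
  funext x
  simp [tensorVec, mul_assoc]

theorem tensorVec_add_left (v v' : (Q → Bool) → ℂ) (w : (R → Bool) → ℂ) :
    tensorVec (v + v') w = tensorVec v w + tensorVec v' w := by
  funext x
  simp [tensorVec, add_mul]

theorem tensor_vecMulVec (v v' : (Q → Bool) → ℂ) (w w' : (R → Bool) → ℂ) :
    tensor (Matrix.vecMulVec v (star v')) (Matrix.vecMulVec w (star w')) =
      Matrix.vecMulVec (tensorVec v w) (star (tensorVec v' w')) := by
  ext y x
  simp only [tensor, Matrix.of_apply, Matrix.vecMulVec_apply, tensorVec, Pi.star_apply, star_mul']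
  ring

theorem tensor_proj (v : (Q → Bool) → ℂ) (w : (R → Bool) → ℂ) :
    tensor (proj v) (proj w) = proj (tensorVec v w) :=
  tensor_vecMulVec v v w w

/-- The relabelling of the qubits of an operator along a bijection. -/
def relabel (e : Q ≃ R) (ρ : Op Q) : Op R :=
  ρ.submatrix (e.arrowCongr (Equiv.refl Bool)).symm (e.arrowCongr (Equiv.refl Bool)).symm

theorem relabel_proj (e : Q ≃ R) (v : (Q → Bool) → ℂ) :
    relabel e (proj v) = proj fun y => v (y ∘ e) :=
  rfl

theorem conjTranspose_relabel (e : Q ≃ R) (ρ : Op Q) : (relabel e ρ)ᴴ = relabel e ρᴴ :=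
  rfl

variable [Fintype Q] [Fintype R]

theorem trace_proj_ket [DecidableEq Q] (x : Q → Bool) : (proj (ket x)).trace = 1 := by
  simp [proj, Matrix.trace_vecMulVec, ket]

theorem sum_norm_sq_ket [DecidableEq Q] (x : Q → Bool) : ∑ y, ‖ket x y‖ ^ 2 = 1 := by
  simp [ket, Pi.single_apply, apply_ite norm, ite_pow]

theorem tensorVec_ket (x : Q → Bool) (z : R → Bool) :
    tensorVec (ket x) (ket z) = ket (Sum.elim x z) := by
  funext y
  have hy : y = Sum.elim x z ↔ (fun i => y (Sum.inl i)) = x ∧ (fun j => y (Sum.inr j)) = z := by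
    simp [funext_iff]
  simp only [tensorVec, ket, Pi.single_apply, hy]
  split_ifs <;> simp_all

theorem relabel_proj_ket (e : Q ≃ R) (x : Q → Bool) :
    relabel e (proj (ket x)) = proj (ket (x ∘ e.symm)) := by
  rw [relabel_proj]
  congr 1
  funext y
  simp only [ket, Pi.single_apply, ← e.eq_comp_symm]

theorem relabel_one (e : Q ≃ R) : relabel e (1 : Op Q) = 1 :=
  Matrix.submatrix_one_equiv _

theorem tensor_one : tensor (1 : Op Q) (1 : Op R) = 1 := by
  simp only [tensor_eq_submatrix_kronecker, Matrix.kronecker, Matrix.one_kronecker_one,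
    Matrix.submatrix_one_equiv]

variable [DecidableEq Q] [DecidableEq R]

theorem relabel_mul (e : Q ≃ R) (ρ τ : Op Q) : relabel e (ρ * τ) = relabel e ρ * relabel e τ :=
  (Matrix.submatrix_mul_equiv _ _ _ _ _).symm

theorem trace_relabel (e : Q ≃ R) (ρ : Op Q) : (relabel e ρ).trace = ρ.trace :=
  (e.arrowCongr (Equiv.refl Bool)).symm.sum_comp fun x => ρ x x

theorem tensor_mul (ρ ρ' : Op Q) (τ τ' : Op R) :
    tensor (ρ * ρ') (τ * τ') = tensor ρ τ * tensor ρ' τ' := by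
  simp only [tensor_eq_submatrix_kronecker, Matrix.kronecker, Matrix.mul_kronecker_mul,
    Matrix.submatrix_mul_equiv]

theorem trace_tensor (ρ : Op Q) (τ : Op R) : (tensor ρ τ).trace = ρ.trace * τ.trace := by
  rw [← Matrix.trace_kronecker]
  exact (Equiv.sumArrowEquivProdArrow Q R Bool).sum_comp fun p => ρ.kronecker τ p p

theorem sum_eq_sum_sum_elim {M : Type*} [AddCommMonoid M] (f : (Q ⊕ R → Bool) → M) :
    ∑ q, f q = ∑ x, ∑ z, f (Sum.elim x z) := by
  rw [← (Equiv.sumArrowEquivProdArrow Q R Bool).symm.sum_comp, Fintype.sum_prod_type]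
  rfl

theorem sum_norm_sq_tensorVec (v : (Q → Bool) → ℂ) (w : (R → Bool) → ℂ) :
    ∑ q, ‖tensorVec v w q‖ ^ 2 = (∑ x, ‖v x‖ ^ 2) * ∑ z, ‖w z‖ ^ 2 := by
  simp only [sum_eq_sum_sum_elim, tensorVec, Sum.elim_inl, Sum.elim_inr, norm_mul, mul_pow,
    Finset.sum_mul_sum]

end Tensor

section Circuits

variable {Q R : Type}

/-- The gate that acts on the qubit `e i` wherever the given gate acts on `i`. -/
def Gate.map (e : Q ↪ R) : Gate Q → Gate R
  | .H i => .H (e i)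
  | .T i => .T (e i)
  | .CNOT c t h => .CNOT (e c) (e t) (e.injective.ne h)

variable [Fintype Q] [DecidableEq Q] [Fintype R] [DecidableEq R]

theorem onQubit_equiv (e : Q ≃ R) (i : Q) (u : Matrix Bool Bool ℂ) :
    onQubit (e i) u = relabel e (onQubit i u) := by
  ext y x
  change ite _ _ _ = ite _ _ _
  simp [e.forall_congr_left, e.symm_apply_eq]

theorem onQubit_inr (i : R) (u : Matrix Bool Bool ℂ) :
    onQubit (Sum.inr i : Q ⊕ R) u = tensor 1 (onQubit i u) := by
  ext y x
  simp only [onQubit, tensor, Matrix.of_apply, Matrix.one_apply, ite_mul, one_mul, zero_mul,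
    ← ite_and, Sum.forall, ne_eq, reduceCtorEq, not_false_eq_true, forall_const, Sum.inr.injEq,
    funext_iff]

theorem Gate.unitary_map_equiv (e : Q ≃ R) (g : Gate Q) :
    (g.map e.toEmbedding).unitary = relabel e g.unitary := by
  cases g with
  | H i => exact onQubit_equiv e i _
  | T i => exact onQubit_equiv e i _
  | CNOT c t h =>
    ext y x
    have hiff : y = Function.update x (e t) (xor (x (e t)) (x (e c))) ↔
        y ∘ e = Function.update (x ∘ e) t (xor (x (e t)) (x (e c))) := by
      rw [← Function.update_comp_eq_of_injective x e.injective,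
        e.surjective.injective_comp_right.eq_iff]
    exact if_congr hiff rfl rfl

theorem Gate.unitary_map_inr (g : Gate R) :
    (g.map (Function.Embedding.inr : R ↪ Q ⊕ R)).unitary = tensor 1 g.unitary := by
  cases g with
  | H i => exact onQubit_inr i _
  | T i => exact onQubit_inr i _
  | CNOT c t h =>
    ext y x
    simp only [Gate.map, Gate.unitary, tensor, Matrix.of_apply, Matrix.one_apply, ite_mul, one_mul,
      zero_mul, ← ite_and, funext_iff, Sum.forall, Function.update_apply, reduceCtorEq, if_false,
      Function.Embedding.inr_apply, Sum.inr.injEq]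

theorem circuitUnitary_map_equiv (e : Q ≃ R) (c : Circuit Q) :
    circuitUnitary (c.map (Gate.map e.toEmbedding)) = relabel e (circuitUnitary c) := by
  induction c with
  | nil => exact (relabel_one e).symm
  | cons g c ih =>
    rw [List.map_cons, circuitUnitary, ih, g.unitary_map_equiv, ← relabel_mul, circuitUnitary]

theorem circuitUnitary_map_inr (c : Circuit R) :
    circuitUnitary (c.map (Gate.map (Function.Embedding.inr : R ↪ Q ⊕ R))) =
      tensor 1 (circuitUnitary c) := by
  induction c with
  | nil => exact tensor_one.symm
  | cons g c ih =>
    rw [List.map_cons, circuitUnitary, ih, g.unitary_map_inr, ← tensor_mul, one_mul,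
      circuitUnitary]

/-- The state that a circuit produces from the state `ρ`. -/
noncomputable def evolve (c : Circuit Q) (ρ : Op Q) : Op Q :=
  circuitUnitary c * ρ * (circuitUnitary c)ᴴ

theorem evolve_map_equiv (e : Q ≃ R) (c : Circuit Q) (ρ : Op Q) :
    evolve (c.map (Gate.map e.toEmbedding)) (relabel e ρ) = relabel e (evolve c ρ) := by
  simp only [evolve, circuitUnitary_map_equiv, conjTranspose_relabel, relabel_mul]

theorem evolve_map_inr (c : Circuit R) (ρ : Op Q) (τ : Op R) :
    evolve (c.map (Gate.map (Function.Embedding.inr : R ↪ Q ⊕ R))) (tensor ρ τ) =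
      tensor ρ (evolve c τ) := by
  simp only [evolve, circuitUnitary_map_inr, conjTranspose_tensor, ← tensor_mul,
    Matrix.conjTranspose_one, one_mul, mul_one]

end Circuits

section Measurement

variable {Q R O P : Type} [Fintype Q] [Fintype R] [Fintype O] [Fintype P]

/-- The projector onto the outcome `y` of a computational-basis measurement of the qubits
`out o`. -/
def outcomeProj (out : O → Q) (y : O → Bool) : Op Q :=
  Matrix.diagonal fun x => if (fun o => x (out o)) = y then 1 else 0

theorem outcomeProj_comp_equiv (e : Q ≃ R) (out : O → Q) (y : O → Bool) :
    outcomeProj (e ∘ out) y = relabel e (outcomeProj out y) := by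
  rw [outcomeProj, outcomeProj, relabel, Matrix.submatrix_diagonal_equiv]
  rfl

theorem outcomeProj_sumMap (f : P → Q) (g : O → R) (z : P → Bool) (y : O → Bool) :
    outcomeProj (Sum.map f g) (Sum.elim z y) = tensor (outcomeProj f z) (outcomeProj g y) := by
  ext x x'
  simp only [outcomeProj, tensor, Matrix.of_apply, Matrix.diagonal_apply, funext_iff, Sum.forall,
    Sum.map_inl, Sum.map_inr, Sum.elim_inl, Sum.elim_inr]
  split_ifs <;> simp_all

theorem outcomeProj_inr (z : R → Bool) :
    outcomeProj (Function.Embedding.inr : R ↪ Q ⊕ R) z = tensor 1 (proj (ket z)) := by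
  ext x x'
  simp only [outcomeProj, tensor, proj, ket, Function.Embedding.inr_apply, Matrix.of_apply,
    Matrix.diagonal_apply, Matrix.one_apply, Matrix.vecMulVec_apply, funext_iff, Sum.forall,
    Pi.single_apply, Pi.star_apply]
  split_ifs <;> simp_all

theorem proj_ket_mul_self [DecidableEq Q] (x : Q → Bool) :
    proj (ket x) * proj (ket x) = proj (ket x) := by
  simp [proj, ket, Matrix.vecMulVec_mul_vecMulVec]

end Measurement

namespace QMachine

/-! ### Constructions of machines -/

section Constructions

variable {I J O P R W : Type}

/-- The bijection that numbers the workspace qubits `W`. -/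
noncomputable def numberWorkspace (I W : Type) [Fintype W] : I ⊕ W ≃ I ⊕ Fin (Fintype.card W) :=
  (Equiv.refl I).sumCongr (Fintype.equivFin W)

theorem finalState_eq_evolve [Fintype I] [DecidableEq I] (A : QMachine I O) (ρ : Op I) :
    A.finalState ρ = evolve A.circuit (tensor ρ (proj A.advice)) :=
  rfl

/-- The machine whose advice `ω` is stored in qubits labelled by an arbitrary finite type `W`. -/
noncomputable def ofWorkspace [Fintype W] [DecidableEq W] (ω : (W → Bool) → ℂ)
    (hω : ∑ w, ‖ω w‖ ^ 2 = 1) (c : Circuit (I ⊕ W)) (out : O ↪ I ⊕ W) : QMachine I O where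
  anc := Fintype.card W
  advice a := ω (a ∘ Fintype.equivFin W)
  advice_unit :=
    (((Fintype.equivFin W).arrowCongr (Equiv.refl Bool)).symm.sum_comp fun w => ‖ω w‖ ^ 2).trans hω
  circuit := c.map (Gate.map (numberWorkspace I W).toEmbedding)
  out := out.trans (numberWorkspace I W).toEmbedding

theorem size_ofWorkspace [Fintype W] [DecidableEq W] (ω : (W → Bool) → ℂ)
    (hω : ∑ w, ‖ω w‖ ^ 2 = 1) (c : Circuit (I ⊕ W)) (out : O ↪ I ⊕ W) :
    (ofWorkspace ω hω c out).size = Fintype.card W + c.length := by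
  simp only [size, ofWorkspace, List.length_map]

theorem outProb_ofWorkspace [Fintype I] [DecidableEq I] [Fintype O] [Fintype W] [DecidableEq W]
    (ω : (W → Bool) → ℂ) (hω : ∑ w, ‖ω w‖ ^ 2 = 1) (c : Circuit (I ⊕ W)) (out : O ↪ I ⊕ W)
    (ρ : Op I) (y : O → Bool) :
    (ofWorkspace ω hω c out).outProb ρ y =
      (outcomeProj out y * evolve c (tensor ρ (proj ω))).trace.re := by
  have hin : tensor ρ (proj (ofWorkspace ω hω c out).advice) =
      relabel (numberWorkspace I W) (tensor ρ (proj ω)) :=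
    rfl
  have hstate : (ofWorkspace ω hω c out).finalState ρ =
      relabel (numberWorkspace I W) (evolve c (tensor ρ (proj ω))) := by
    rw [finalState_eq_evolve, hin]
    exact evolve_map_equiv (numberWorkspace I W) c _
  have hout : (ofWorkspace ω hω c out).outcome y =
      relabel (numberWorkspace I W) (outcomeProj out y) :=
    outcomeProj_comp_equiv (numberWorkspace I W) out y
  have hmul : (ofWorkspace ω hω c out).outcome y * (ofWorkspace ω hω c out).finalState ρ =
      relabel (numberWorkspace I W) (outcomeProj out y * evolve c (tensor ρ (proj ω))) := by
    rw [relabel_mul, hstate, hout]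
    rfl
  exact congrArg Complex.re ((congrArg Matrix.trace hmul).trans (trace_relabel _ _))

/-- The arrangement of the qubits of a machine some of whose input bits are kept in the
workspace. -/
def hardwireEquiv (e : J ⊕ I ≃ R) (K : Type) : R ⊕ K ≃ J ⊕ (I ⊕ K) :=
  (e.symm.sumCongr (Equiv.refl K)).trans (Equiv.sumAssoc J I K)

/-- Runs `A` on the input qubits `J` together with the fixed bits `v` in the qubits `I`. -/
noncomputable def hardwire [Fintype I] [DecidableEq I] (A : QMachine R O) (e : J ⊕ I ≃ R)
    (v : I → Bool) : QMachine J O :=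
  ofWorkspace (tensorVec (ket v) A.advice)
    (by rw [sum_norm_sq_tensorVec, sum_norm_sq_ket, A.advice_unit, one_mul])
    (A.circuit.map (Gate.map (hardwireEquiv e (Fin A.anc)).toEmbedding))
    (A.out.trans (hardwireEquiv e (Fin A.anc)).toEmbedding)

theorem size_hardwire [Fintype I] [DecidableEq I] (A : QMachine R O) (e : J ⊕ I ≃ R)
    (v : I → Bool) : (A.hardwire e v).size = Fintype.card I + A.size := by
  rw [hardwire, size_ofWorkspace, Fintype.card_sum, Fintype.card_fin, List.length_map, size,
    add_assoc]

theorem outProb_hardwire [Fintype I] [DecidableEq I] [Fintype J] [DecidableEq J] [Fintype R]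
    [DecidableEq R] [Fintype O] (A : QMachine R O) (e : J ⊕ I ≃ R) (v : I → Bool) (ρ : Op J)
    (y : O → Bool) :
    (A.hardwire e v).outProb ρ y = A.outProb (relabel e (tensor ρ (proj (ket v)))) y := by
  have hin : tensor ρ (proj (tensorVec (ket v) A.advice)) =
      relabel (hardwireEquiv e (Fin A.anc))
        (tensor (relabel e (tensor ρ (proj (ket v)))) (proj A.advice)) := by
    rw [← tensor_proj]
    ext y x
    simp [relabel, hardwireEquiv, tensor, mul_assoc, Function.comp_def]
  rw [hardwire, outProb_ofWorkspace, hin, evolve_map_equiv, Function.Embedding.coe_trans,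
    Equiv.coe_toEmbedding, outcomeProj_comp_equiv, ← relabel_mul, trace_relabel]
  rfl

/-- The arrangement of the qubits of a machine that is extended by further input qubits `J` and
further workspace qubits `P`. -/
def padEquiv (I J P K : Type) : (J ⊕ P) ⊕ (I ⊕ K) ≃ (I ⊕ J) ⊕ (K ⊕ P) :=
  (Equiv.sumComm _ _).trans (Equiv.sumSumSumComm I K J P)

/-- Runs `B` on the input qubits `I`, ignores the input qubits `J`, and outputs the fixed bits `m`
alongside the output of `B`. -/
noncomputable def pad [Fintype P] [DecidableEq P] (B : QMachine I O) (J : Type) (m : P → Bool) :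
    QMachine (I ⊕ J) (P ⊕ O) :=
  ofWorkspace (tensorVec B.advice (ket m))
    (by rw [sum_norm_sq_tensorVec, sum_norm_sq_ket, B.advice_unit, one_mul])
    ((B.circuit.map (Gate.map .inr)).map (Gate.map (padEquiv I J P (Fin B.anc)).toEmbedding))
    ((Function.Embedding.inr.sumMap B.out).trans (padEquiv I J P (Fin B.anc)).toEmbedding)

theorem size_pad [Fintype P] [DecidableEq P] (B : QMachine I O) (J : Type) (m : P → Bool) :
    (B.pad J m).size = Fintype.card P + B.size := by
  rw [pad, size_ofWorkspace, Fintype.card_sum, Fintype.card_fin, List.length_map, List.length_map,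
    size]
  ring

theorem outProb_pad [Fintype I] [DecidableEq I] [Fintype J] [DecidableEq J] [Fintype P]
    [DecidableEq P] [Fintype O] (B : QMachine I O) (m : P → Bool) (ρ : Op I) {τ : Op J}
    (hτ : τ.trace = 1) (y : O → Bool) :
    (B.pad J m).outProb (tensor ρ τ) (Sum.elim m y) = B.outProb ρ y := by
  have hin : tensor (tensor ρ τ) (proj (tensorVec B.advice (ket m))) =
      relabel (padEquiv I J P (Fin B.anc))
        (tensor (tensor τ (proj (ket m))) (tensor ρ (proj B.advice))) := by
    rw [← tensor_proj]
    ext y x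
    exact (mul_mul_mul_comm _ _ _ _).trans (mul_comm _ _)
  have hm : (outcomeProj (Function.Embedding.inr : P ↪ J ⊕ P) m *
      tensor τ (proj (ket m))).trace = 1 := by
    rw [outcomeProj_inr, ← tensor_mul, one_mul, proj_ket_mul_self, trace_tensor, hτ,
      trace_proj_ket, one_mul]
  rw [pad, outProb_ofWorkspace, hin, evolve_map_equiv, evolve_map_inr, Function.Embedding.coe_trans,
    Equiv.coe_toEmbedding, outcomeProj_comp_equiv, ← relabel_mul, trace_relabel,
    Function.Embedding.coe_sumMap, outcomeProj_sumMap, ← tensor_mul,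
    trace_tensor, hm, one_mul]
  rfl

/-- Measures only the output qubits in the range of `f`. -/
def restrictOut (A : QMachine I O) (f : P ↪ O) : QMachine I P where
  anc := A.anc
  advice := A.advice
  advice_unit := A.advice_unit
  circuit := A.circuit
  out := f.trans A.out

/-- The circuit that runs `A`, flips the sign of the accepting branch and runs `A` backwards. The
sign is flipped by the gate `Z = T⁴`. -/
def reflection (A : QMachine I Unit) : Circuit (I ⊕ Fin A.anc) :=
  A.circuit ++ (List.replicate 4 (.T (A.out ())) ++ inverseCircuit A.circuit)

/-- Runs the reflection about the rejecting subspace of `A` and measures the input qubits. -/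
def reflect (A : QMachine I Unit) : QMachine I I where
  anc := A.anc
  advice := A.advice
  advice_unit := A.advice_unit
  circuit := A.reflection
  out := .inl

theorem size_reflect_le (A : QMachine I Unit) : A.reflect.size ≤ 8 * A.size + 4 := by
  have := length_inverseCircuit_le A.circuit
  simp only [reflect, reflection, size, List.length_append, List.length_replicate]
  omega

end Constructions
end QMachine

namespace QMachine

/-! ### Interference -/

section OutProb

variable {I O P : Type} [Fintype I]

theorem conjTranspose_outcome [Fintype O] (A : QMachine I O) (y : O → Bool) :
    (A.outcome y)ᴴ = A.outcome y := by
  rw [outcome, Matrix.diagonal_conjTranspose]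
  congr 1
  funext x
  simp only [Pi.star_apply, apply_ite star, star_one, star_zero]

variable [DecidableEq I]

theorem conjTranspose_finalState (A : QMachine I O) (ρ : Op I) :
    (A.finalState ρ)ᴴ = A.finalState ρᴴ := by
  simp only [finalState, Matrix.conjTranspose_mul, Matrix.conjTranspose_conjTranspose,
    conjTranspose_tensor, proj, Matrix.conjTranspose_vecMulVec, star_star, mul_assoc]

/-- The state vector just before the measurement, on the input state vector `χ`. -/
noncomputable def finalVec (A : QMachine I O) (χ : (I → Bool) → ℂ) :
    (I ⊕ Fin A.anc → Bool) → ℂ :=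
  circuitUnitary A.circuit *ᵥ tensorVec χ A.advice

theorem finalState_vecMulVec (A : QMachine I O) (χ ξ : (I → Bool) → ℂ) :
    A.finalState (Matrix.vecMulVec χ (star ξ)) =
      Matrix.vecMulVec (A.finalVec χ) (star (A.finalVec ξ)) := by
  rw [finalState, proj, tensor_vecMulVec, Matrix.mul_vecMulVec, Matrix.vecMulVec_mul, finalVec,
    finalVec, Matrix.star_mulVec]

variable [Fintype O] [Fintype P]

theorem outProb_add (A : QMachine I O) (ρ τ : Op I) (y : O → Bool) :
    A.outProb (ρ + τ) y = A.outProb ρ y + A.outProb τ y := by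
  simp [outProb, finalState, tensor_add_left, mul_add, add_mul]

theorem outProb_smul (A : QMachine I O) (c : ℝ) (ρ : Op I) (y : O → Bool) :
    A.outProb ((c : ℂ) • ρ) y = c * A.outProb ρ y := by
  simp [outProb, finalState, tensor_smul_left, -Complex.coe_smul]

theorem outProb_sum {ι : Type*} (A : QMachine I O) (s : Finset ι) (ρ : ι → Op I) (y : O → Bool) :
    A.outProb (∑ i ∈ s, ρ i) y = ∑ i ∈ s, A.outProb (ρ i) y :=
  map_sum (AddMonoidHom.mk' (fun ρ => A.outProb ρ y) fun ρ τ => A.outProb_add ρ τ y) ρ s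

theorem outProb_conjTranspose (A : QMachine I O) (ρ : Op I) (y : O → Bool) :
    A.outProb ρᴴ y = A.outProb ρ y := by
  rw [outProb, outProb, ← conjTranspose_finalState, ← conjTranspose_outcome,
    ← Matrix.conjTranspose_mul, Matrix.trace_conjTranspose, Matrix.trace_mul_comm,
    conjTranspose_outcome]
  exact Complex.conj_re _

theorem outProb_superposition_sub_mixture (A : QMachine I O) (χ ξ : (I → Bool) → ℂ)
    (y : O → Bool) :
    A.outProb (proj (((1 / Real.sqrt 2 : ℝ) : ℂ) • (χ + ξ))) y -
        A.outProb ((1 / 2 : ℂ) • (proj χ + proj ξ)) y =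
      A.outProb (Matrix.vecMulVec χ (star ξ)) y := by
  have hhalf : (1 / 2 : ℂ) = ((1 / 2 : ℝ) : ℂ) := by norm_num
  have hsqrt : ((1 / Real.sqrt 2 : ℝ) : ℂ) * star ((1 / Real.sqrt 2 : ℝ) : ℂ) =
      ((1 / 2 : ℝ) : ℂ) := by
    rw [Complex.star_def, Complex.conj_ofReal, ← Complex.ofReal_mul, div_mul_div_comm, one_mul,
      Real.mul_self_sqrt (by norm_num)]
  have hproj : proj (((1 / Real.sqrt 2 : ℝ) : ℂ) • (χ + ξ)) =
      ((1 / 2 : ℝ) : ℂ) • (proj χ + proj ξ) +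
        ((1 / 2 : ℝ) : ℂ) • (Matrix.vecMulVec χ (star ξ) + (Matrix.vecMulVec χ (star ξ))ᴴ) := by
    rw [proj, star_smul, Matrix.smul_vecMulVec, Matrix.vecMulVec_smul, smul_smul, hsqrt,
      ← smul_add, star_add, Matrix.add_vecMulVec, Matrix.vecMulVec_add, Matrix.vecMulVec_add,
      Matrix.conjTranspose_vecMulVec, star_star, proj, proj]
    congr 1
    abel
  rw [hhalf, hproj, outProb_add, add_sub_cancel_left, outProb_smul, outProb_add,
    outProb_conjTranspose]
  ring

theorem outProb_vecMulVec (A : QMachine I O) (χ ξ : (I → Bool) → ℂ) (y : O → Bool) :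
    A.outProb (Matrix.vecMulVec χ (star ξ)) y =
      (star (A.finalVec ξ) ⬝ᵥ (A.outcome y *ᵥ A.finalVec χ)).re := by
  rw [outProb, finalState_vecMulVec, Matrix.mul_vecMulVec, Matrix.trace_vecMulVec, dotProduct_comm]

theorem outProb_proj (A : QMachine I O) (χ : (I → Bool) → ℂ) (y : O → Bool) :
    A.outProb (proj χ) y =
      ∑ x, if (fun o => x (A.out o)) = y then ‖A.finalVec χ x‖ ^ 2 else 0 := by
  rw [proj, outProb_vecMulVec, dotProduct, Complex.re_sum]
  refine Finset.sum_congr rfl fun x _ => ?_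
  rw [outcome, Matrix.mulVec_diagonal, Pi.star_apply, Complex.star_def]
  split_ifs
  · rw [one_mul, ← Complex.normSq_eq_conj_mul_self, Complex.ofReal_re, Complex.normSq_eq_norm_sq]
  · simp only [zero_mul, mul_zero, Complex.zero_re]

theorem outProb_proj_nonneg (A : QMachine I O) (χ : (I → Bool) → ℂ) (y : O → Bool) :
    0 ≤ A.outProb (proj χ) y := by
  rw [outProb_proj]
  exact Finset.sum_nonneg fun x _ => by split_ifs <;> positivity

theorem outProb_le_outProb_restrictOut (A : QMachine I O) (f : P ↪ O) (χ : (I → Bool) → ℂ)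
    (y : O → Bool) :
    A.outProb (proj χ) y ≤ (A.restrictOut f).outProb (proj χ) (y ∘ f) := by
  rw [outProb_proj, outProb_proj]
  refine Finset.sum_le_sum fun x _ => ?_
  split_ifs with hout hrestrict
  · exact le_rfl
  · exact absurd (congrArg (· ∘ f) hout) hrestrict
  · positivity
  · exact le_rfl

end OutProb

end QMachine

theorem norm_sq_star_dotProduct_le {α : Type*} [Fintype α] (v w : α → ℂ) :
    ‖star v ⬝ᵥ w‖ ^ 2 ≤ (∑ a, ‖v a‖ ^ 2) * ∑ a, ‖w a‖ ^ 2 := by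
  have htri : ‖star v ⬝ᵥ w‖ ≤ ∑ a, ‖v a‖ * ‖w a‖ :=
    (norm_sum_le _ _).trans_eq <| by simp only [norm_mul, Pi.star_apply, norm_star]
  exact (pow_le_pow_left₀ (norm_nonneg _) htri 2).trans (Finset.sum_mul_sq_le_sq_mul_sq _ _ _)

theorem star_tensorVec_ket_dotProduct {Q R : Type} [Fintype Q] [DecidableEq Q] [Fintype R]
    [DecidableEq R] (z : Q → Bool) (w : (R → Bool) → ℂ) (φ : (Q ⊕ R → Bool) → ℂ) :
    star (tensorVec (ket z) w) ⬝ᵥ φ = star w ⬝ᵥ fun a => φ (Sum.elim z a) := by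
  rw [dotProduct, sum_eq_sum_sum_elim, Fintype.sum_eq_single z fun x hx => ?_]
  · simp [tensorVec, ket, dotProduct]
  · simp [tensorVec, ket, hx]

namespace QMachine

section Reflect

variable {I O : Type} [Fintype I] [DecidableEq I]

theorem outProb_proj_of_out_eq_inl (A : QMachine I I) (hout : A.out = .inl)
    (χ : (I → Bool) → ℂ) (z : I → Bool) :
    A.outProb (proj χ) z = ∑ a, ‖A.finalVec χ (Sum.elim z a)‖ ^ 2 := by
  simp only [outProb_proj, hout, Function.Embedding.inl_apply]
  rw [sum_eq_sum_sum_elim, Fintype.sum_eq_single z fun x hx => ?_]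
  · simp
  · simp [hx]

theorem norm_sq_dotProduct_finalVec_le_outProb (A : QMachine I I) (hout : A.out = .inl)
    (χ : (I → Bool) → ℂ) (z : I → Bool) :
    ‖star (tensorVec (ket z) A.advice) ⬝ᵥ A.finalVec χ‖ ^ 2 ≤ A.outProb (proj χ) z := by
  rw [star_tensorVec_ket_dotProduct, A.outProb_proj_of_out_eq_inl hout]
  simpa only [A.advice_unit, one_mul] using norm_sq_star_dotProduct_le A.advice _

theorem star_dotProduct_tensorVec_ket_of_ne (A : QMachine I O) {z z' : I → Bool} (h : z ≠ z') :
    star (tensorVec (ket z') A.advice) ⬝ᵥ tensorVec (ket z) A.advice = 0 := by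
  rw [star_tensorVec_ket_dotProduct]
  simp [tensorVec, ket, h.symm, dotProduct]

theorem unitary_T_out_pow_four (A : QMachine I Unit) :
    (Gate.T (A.out ())).unitary ^ 4 = 1 - (2 : ℂ) • A.outcome fun _ => true := by
  rw [unitary_T_pow_four, outcome, ← Matrix.diagonal_one, ← Matrix.diagonal_smul,
    Matrix.diagonal_sub]
  congr 1
  funext x
  cases hx : x (A.out ()) <;> simp [hx, funext_iff]
  norm_num

theorem circuitUnitary_reflection (A : QMachine I Unit) :
    circuitUnitary A.reflection = (circuitUnitary A.circuit)ᴴ *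
      (1 - (2 : ℂ) • A.outcome fun _ => true) * circuitUnitary A.circuit := by
  rw [reflection, circuitUnitary_append, circuitUnitary_append, circuitUnitary_replicate,
    unitary_T_out_pow_four, circuitUnitary_inverseCircuit]

theorem star_dotProduct_finalVec_reflect (A : QMachine I Unit) {z z' : I → Bool} (h : z ≠ z') :
    star (tensorVec (ket z') A.advice) ⬝ᵥ A.reflect.finalVec (ket z) =
      -2 * (star (A.finalVec (ket z')) ⬝ᵥ ((A.outcome fun _ => true) *ᵥ A.finalVec (ket z))) := by
  have hunitary : (circuitUnitary A.circuit)ᴴ * circuitUnitary A.circuit = 1 :=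
    Matrix.mem_unitaryGroup_iff'.1 (circuitUnitary_mem_unitaryGroup A.circuit)
  have hreflect : A.reflect.finalVec (ket z) =
      tensorVec (ket z) A.advice - (2 : ℂ) • ((circuitUnitary A.circuit)ᴴ *ᵥ
        ((A.outcome fun _ => true) *ᵥ A.finalVec (ket z))) := by
    change circuitUnitary A.reflection *ᵥ tensorVec (ket z) A.advice = _
    rw [circuitUnitary_reflection, mul_sub, sub_mul, mul_one, hunitary, Matrix.sub_mulVec,
      Matrix.one_mulVec, Matrix.mul_smul, Matrix.smul_mul, Matrix.smul_mulVec,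
      ← Matrix.mulVec_mulVec, ← Matrix.mulVec_mulVec, finalVec]
  rw [hreflect, dotProduct_sub, A.star_dotProduct_tensorVec_ket_of_ne h, dotProduct_smul,
    Matrix.dotProduct_mulVec, ← Matrix.star_mulVec, ← finalVec, zero_sub, smul_eq_mul, neg_mul]

theorem sq_two_mul_outProb_vecMulVec_le (A : QMachine I Unit) {z z' : I → Bool} (h : z ≠ z') :
    (2 * A.outProb (Matrix.vecMulVec (ket z) (star (ket z'))) fun _ => true) ^ 2 ≤
      A.reflect.outProb (proj (ket z)) z' := by
  calc (2 * A.outProb (Matrix.vecMulVec (ket z) (star (ket z'))) fun _ => true) ^ 2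
      ≤ ‖star (tensorVec (ket z') A.advice) ⬝ᵥ A.reflect.finalVec (ket z)‖ ^ 2 := by
        rw [A.star_dotProduct_finalVec_reflect h, outProb_vecMulVec, norm_mul, norm_neg,
          Complex.norm_ofNat, mul_pow, mul_pow, ← sq_abs (Complex.re _)]
        gcongr
        exact Complex.abs_re_le_norm _
    _ ≤ A.reflect.outProb (proj (ket z)) z' :=
        A.reflect.norm_sq_dotProduct_finalVec_le_outProb rfl (ket z) z'

end Reflect

end QMachine

/-! ### Signatures -/

section FiniteProbability

variable {α β : Type*} [Fintype α] [Fintype β]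

theorem sum_toReal_pmf (p : PMF α) : ∑ a, (p a).toReal = 1 := by
  rw [← ENNReal.toReal_sum fun a _ => p.apply_ne_top a, ← tsum_fintype (L := .unconditional α),
    p.tsum_coe, ENNReal.toReal_one]

theorem sum_toReal_map_mul (p : PMF α) (f : α → β) (h : β → ℝ) :
    ∑ b, (p.map f b).toReal * h b = ∑ a, (p a).toReal * h (f a) := by
  classical
  have hmap : ∀ b, (p.map f b).toReal = ∑ a, if b = f a then (p a).toReal else 0 := fun b => by
    have htop : ∀ a ∈ Finset.univ, (if b = f a then p a else 0) ≠ ⊤ := fun a _ => by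
      split_ifs
      exacts [p.apply_ne_top a, ENNReal.zero_ne_top]
    rw [PMF.map_apply, tsum_fintype, ENNReal.toReal_sum htop]
    simp only [apply_ite ENNReal.toReal, ENNReal.toReal_zero]
  simp only [hmap, Finset.sum_mul]
  rw [Finset.sum_comm]
  simp [ite_mul]

theorem sq_sum_toReal_mul_le (p : PMF α) (f : α → ℝ) :
    (∑ a, (p a).toReal * f a) ^ 2 ≤ ∑ a, (p a).toReal * f a ^ 2 :=
  Real.pow_arith_mean_le_arith_mean_pow_of_even Finset.univ _ f (fun _ _ => ENNReal.toReal_nonneg)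
    (sum_toReal_pmf p) even_two

theorem exists_sum_toReal_mul_le (p : PMF α) (f : α → ℝ) :
    ∃ a, ∑ b, (p b).toReal * f b ≤ f a := by
  have : Nonempty α := p.support_nonempty.to_subtype.map Subtype.val
  obtain ⟨a, ha⟩ := Finite.exists_max f
  refine ⟨a, ?_⟩
  calc ∑ b, (p b).toReal * f b ≤ ∑ b, (p b).toReal * f a :=
        Finset.sum_le_sum fun b _ => mul_le_mul_of_nonneg_left (ha b) ENNReal.toReal_nonneg
    _ = f a := by rw [← Finset.sum_mul, sum_toReal_pmf, one_mul]

end FiniteProbability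

theorem Negligible.of_sq_le {f ν : ℕ → ℝ} (hν : Negligible ν) (h : ∀ n, f n ^ 2 ≤ ν n) :
    Negligible f := by
  intro k
  have hsq : Filter.Tendsto (fun n : ℕ => ((n : ℝ) ^ k * f n) ^ 2) Filter.atTop (nhds 0) := by
    refine squeeze_zero (fun n => sq_nonneg _) (fun n => ?_) (hν (k * 2))
    rw [mul_pow, ← pow_mul]
    exact mul_le_mul_of_nonneg_left (h n) (by positivity)
  have habs := hsq.sqrt
  simp only [Real.sqrt_sq_eq_abs, Real.sqrt_zero] at habs
  exact (tendsto_zero_iff_abs_tendsto_zero _).2 habs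

theorem Negligible.of_le {f ν : ℕ → ℝ} (hν : Negligible ν) (h₀ : ∀ n, 0 ≤ f n)
    (h : ∀ n, f n ≤ ν n) : Negligible f :=
  Asymptotics.SuperpolynomialDecay.trans_abs_le hν fun n =>
    abs_le_abs_of_nonneg (h₀ n) (h n)

theorem IsQPT.of_size_le {I O I' O' : ℕ → Type} {A : ∀ n, QMachine (I n) (O n)} (hA : IsQPT A)
    {B : ∀ n, QMachine (I' n) (O' n)} (c : ℕ) (q : Polynomial ℕ)
    (h : ∀ n, (B n).size ≤ c * (A n).size + q.eval n) : IsQPT B := by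
  obtain ⟨p, hp⟩ := hA
  refine ⟨Polynomial.C c * p + q, fun n => (h n).trans ?_⟩
  rw [Polynomial.eval_add, Polynomial.eval_mul, Polynomial.eval_C]
  gcongr
  exact hp n

namespace OTS

variable {S : OTS} {n : ℕ}

theorem map_fst_signed (m : BitStr (S.msgLen n)) :
    (S.signed n m).map Prod.fst = (S.gen n).map Prod.fst := by
  rw [signed, PMF.map_bind, ← PMF.bind_pure_comp]
  congr 1
  funext k
  rw [PMF.map_comp]
  exact PMF.map_const _ _

theorem sum_signed_mul_fst (m : BitStr (S.msgLen n)) (h : BitStr (S.vkLen n) → ℝ) :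
    ∑ k, (S.signed n m k).toReal * h k.1 = ∑ k, (S.gen n k).toReal * h k.1 := by
  rw [← sum_toReal_map_mul _ Prod.fst, map_fst_signed, sum_toReal_map_mul]

theorem Correct.ver_eq_one (hS : S.Correct) {m : BitStr (S.msgLen n)}
    {k : BitStr (S.vkLen n) × BitStr (S.sigLen n)} (hk : S.signed n m k ≠ 0) :
    S.ver n k.1 m k.2 true = 1 := by
  have hbind : ((S.signed n m).bind fun k => S.ver n k.1 m k.2) true = 1 := by
    rw [← hS n m, signed, PMF.bind_bind]
    congr 2
    funext k
    rw [PMF.bind_map]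
    rfl
  rw [PMF.apply_eq_one_iff, PMF.support_bind] at hbind
  rw [PMF.apply_eq_one_iff, ← (PMF.support_nonempty _).subset_singleton_iff, ← hbind]
  exact Set.subset_biUnion_of_mem (u := fun k => (S.ver n k.1 m k.2).support)
    ((PMF.mem_support_iff _ _).2 hk)

variable (S n) in
/-- The probability that `A`, given only a verification key, outputs a signature on the message
`m` that is accepted under this key. -/
noncomputable def keyOnlyForgeProb (A : QMachine (Fin (S.vkLen n)) (Fin (S.sigLen n)))
    (m : BitStr (S.msgLen n)) : ℝ :=
  ∑ k, (S.gen n k).toReal *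
    ∑ σ, A.outProb (proj (ket k.1)) σ * (S.ver n k.1 m σ true).toReal

variable (S) in
/-- Unforgeability against key-only attacks on the messages `m n`, which are fixed in advance: no
QPT machine signs them when given only a verification key. -/
def KeyOnlyUnforgeable (m : ∀ n, BitStr (S.msgLen n)) : Prop :=
  ∀ A : ∀ n, QMachine (Fin (S.vkLen n)) (Fin (S.sigLen n)), IsQPT A →
    Negligible fun n => S.keyOnlyForgeProb n (A n) (m n)

theorem outProb_mul_ver_nonneg {I : Type} [Fintype I] [DecidableEq I]
    (A : QMachine I (Fin (S.sigLen n))) (x : I → Bool) (vk : BitStr (S.vkLen n))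
    (m : BitStr (S.msgLen n)) (σ : BitStr (S.sigLen n)) :
    0 ≤ A.outProb (proj (ket x)) σ * (S.ver n vk m σ true).toReal :=
  mul_nonneg (A.outProb_proj_nonneg _ _) ENNReal.toReal_nonneg

theorem keyOnlyForgeProb_nonneg (A : QMachine (Fin (S.vkLen n)) (Fin (S.sigLen n)))
    (m : BitStr (S.msgLen n)) : 0 ≤ S.keyOnlyForgeProb n A m :=
  Finset.sum_nonneg fun _ _ => mul_nonneg ENNReal.toReal_nonneg <|
    Finset.sum_nonneg fun σ _ => outProb_mul_ver_nonneg A _ _ m σ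

theorem sum_signed_mul_outProb_le_keyOnlyForgeProb (hS : S.Correct)
    (A : QMachine (Fin (S.vkLen n)) (Fin (S.sigLen n))) (m : BitStr (S.msgLen n)) :
    ∑ k, (S.signed n m k).toReal * A.outProb (proj (ket k.1)) k.2 ≤
      S.keyOnlyForgeProb n A m := by
  rw [keyOnlyForgeProb, ← sum_signed_mul_fst m fun vk =>
    ∑ σ, A.outProb (proj (ket vk)) σ * (S.ver n vk m σ true).toReal]
  refine Finset.sum_le_sum fun k _ => ?_
  by_cases hk : S.signed n m k = 0
  · simp only [hk, ENNReal.toReal_zero, zero_mul, le_refl]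
  refine mul_le_mul_of_nonneg_left ?_ ENNReal.toReal_nonneg
  calc A.outProb (proj (ket k.1)) k.2
      = A.outProb (proj (ket k.1)) k.2 * (S.ver n k.1 m k.2 true).toReal := by
        rw [hS.ver_eq_one hk, ENNReal.toReal_one, mul_one]
    _ ≤ ∑ σ, A.outProb (proj (ket k.1)) σ * (S.ver n k.1 m σ true).toReal :=
        Finset.single_le_sum (fun σ _ => outProb_mul_ver_nonneg A k.1 k.1 m σ)
          (Finset.mem_univ k.2)

theorem keyOnlyForgeProb_le_forgeProb_pad (A : QMachine (Fin (S.vkLen n)) (Fin (S.sigLen n)))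
    {m m' : BitStr (S.msgLen n)} (hm : m ≠ m') :
    S.keyOnlyForgeProb n A m ≤
      S.forgeProb n (A.pad (Fin (S.msgLen n) ⊕ Fin (S.sigLen n)) m) m' := by
  rw [keyOnlyForgeProb, forgeProb, ← sum_signed_mul_fst m' fun vk =>
    ∑ σ, A.outProb (proj (ket vk)) σ * (S.ver n vk m σ true).toReal]
  refine Finset.sum_le_sum fun k _ => mul_le_mul_of_nonneg_left ?_ ENNReal.toReal_nonneg
  rw [Fintype.sum_prod_type]
  refine le_trans (le_of_eq ?_) (Finset.single_le_sum (fun m₀ _ => ?_) (Finset.mem_univ m))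
  · refine Finset.sum_congr rfl fun σ _ => ?_
    rw [if_neg fun he => hm (congrArg Prod.fst he), ← tensorVec_ket, ← tensor_proj,
      A.outProb_pad m _ (trace_proj_ket _)]
  · refine Finset.sum_nonneg fun σ _ => ?_
    split_ifs
    exacts [le_rfl, mul_nonneg (QMachine.outProb_proj_nonneg _ _ _) ENNReal.toReal_nonneg]

theorem StronglyUnforgeable.keyOnlyUnforgeable (hS : S.StronglyUnforgeable)
    {m m' : ∀ n, BitStr (S.msgLen n)} (hm : ∀ n, m n ≠ m' n) : S.KeyOnlyUnforgeable m := by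
  intro A hA
  obtain ⟨q, hq⟩ := S.poly_len
  have hpad : IsQPT fun n => (A n).pad (Fin (S.msgLen n) ⊕ Fin (S.sigLen n)) (m n) :=
    hA.of_size_le 1 q fun n => by
      have hlen := hq n
      rw [QMachine.size_pad, Fintype.card_fin]
      omega
  obtain ⟨ν, hν, hle⟩ := hS _ hpad
  exact hν.of_le (fun n => keyOnlyForgeProb_nonneg (A n) (m n)) fun n =>
    (keyOnlyForgeProb_le_forgeProb_pad (A n) (hm n)).trans (hle n (m' n))

/-! ### From distinguishing to forging -/

/-- The contents `|b, σ⟩, (vk₀, vk₁)` of the input register of a distinguisher. -/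
def inputBits (b : Bool) (σ : BitStr (S.sigLen n)) (vk₀ vk₁ : BitStr (S.vkLen n)) :
    S.SigReg n ⊕ S.KeyReg n → Bool :=
  Sum.elim (Sum.elim (fun _ => b) σ) (Sum.elim vk₀ vk₁)

theorem tensor_superposition (σ₀ σ₁ : BitStr (S.sigLen n)) (vk₀ vk₁ : BitStr (S.vkLen n)) :
    tensor (S.superposition n σ₀ σ₁) (proj (ket (Sum.elim vk₀ vk₁))) =
      proj (((1 / Real.sqrt 2 : ℝ) : ℂ) •
        (ket (inputBits false σ₀ vk₀ vk₁) + ket (inputBits true σ₁ vk₀ vk₁))) := by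
  simp only [superposition, tensor_proj, tensorVec_smul_left, tensorVec_add_left, sigKet,
    tensorVec_ket, inputBits]

theorem tensor_mixture (σ₀ σ₁ : BitStr (S.sigLen n)) (vk₀ vk₁ : BitStr (S.vkLen n)) :
    tensor (S.mixture n σ₀ σ₁) (proj (ket (Sum.elim vk₀ vk₁))) =
      (1 / 2 : ℂ) • (proj (ket (inputBits false σ₀ vk₀ vk₁)) +
        proj (ket (inputBits true σ₁ vk₀ vk₁))) := by
  simp only [mixture, tensor_smul_left, tensor_add_left, tensor_proj, sigKet, tensorVec_ket,
    inputBits]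

theorem outProb_ensemble (bit : ∀ n, Bool ↪ BitStr (S.msgLen n))
    (ρ : ∀ n, BitStr (S.sigLen n) → BitStr (S.sigLen n) → Op (S.SigReg n))
    {O : Type} [Fintype O] (A : QMachine (S.SigReg n ⊕ S.KeyReg n) O) (y : O → Bool) :
    A.outProb (S.ensemble bit ρ n) y =
      ∑ k₀, (S.signed n (bit n false) k₀).toReal * ∑ k₁, (S.signed n (bit n true) k₁).toReal *
        A.outProb (tensor (ρ n k₀.2 k₁.2) (proj (ket (Sum.elim k₀.1 k₁.1)))) y := by
  simp only [ensemble, QMachine.outProb_sum, QMachine.outProb_smul, Finset.mul_sum, mul_assoc]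

/-- The contribution of the key-signature pairs `k₀`, `k₁` to the distinguishing advantage of
`A`. -/
noncomputable def interference (A : QMachine (S.SigReg n ⊕ S.KeyReg n) Unit)
    (k₀ k₁ : BitStr (S.vkLen n) × BitStr (S.sigLen n)) : ℝ :=
  A.outProb (Matrix.vecMulVec (ket (inputBits false k₀.2 k₀.1 k₁.1))
    (star (ket (inputBits true k₁.2 k₀.1 k₁.1)))) fun _ => true

theorem outProb_ensemble_superposition_sub_mixture (bit : ∀ n, Bool ↪ BitStr (S.msgLen n))
    (A : QMachine (S.SigReg n ⊕ S.KeyReg n) Unit) :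
    A.outProb (S.ensemble bit S.superposition n) (fun _ => true) -
        A.outProb (S.ensemble bit S.mixture n) (fun _ => true) =
      ∑ k₀, (S.signed n (bit n false) k₀).toReal * ∑ k₁, (S.signed n (bit n true) k₁).toReal *
        interference A k₀ k₁ := by
  simp only [outProb_ensemble, ← Finset.sum_sub_distrib, ← mul_sub, tensor_superposition,
    tensor_mixture, QMachine.outProb_superposition_sub_mixture, interference]

/-- Reflects `|0, σ₀⟩, (vk₀, vk)` about the rejecting subspace of `A` and outputs the signature
register; here `(vk₀, σ₀)` is hardwired and `vk` is the input. -/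
noncomputable def forger (A : QMachine (S.SigReg n ⊕ S.KeyReg n) Unit)
    (k₀ : BitStr (S.vkLen n) × BitStr (S.sigLen n)) :
    QMachine (Fin (S.vkLen n)) (Fin (S.sigLen n)) :=
  (A.reflect.restrictOut (.trans .inr .inl)).hardwire
    ((Equiv.sumComm _ _).trans (Equiv.sumAssoc (S.SigReg n) _ _))
    (Sum.elim (Sum.elim (fun _ => false) k₀.2) k₀.1)

theorem size_forger_le (A : QMachine (S.SigReg n ⊕ S.KeyReg n) Unit)
    (k₀ : BitStr (S.vkLen n) × BitStr (S.sigLen n)) :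
    (forger A k₀).size ≤ 8 * A.size + (S.sigLen n + S.vkLen n + 5) := by
  have hreflect : (A.reflect.restrictOut (.trans .inr .inl : Fin (S.sigLen n) ↪ _)).size ≤
      8 * A.size + 4 :=
    A.size_reflect_le
  rw [forger, QMachine.size_hardwire, Fintype.card_sum, Fintype.card_sum, Fintype.card_unit,
    Fintype.card_fin, Fintype.card_fin]
  omega

theorem outProb_reflect_le_outProb_forger (A : QMachine (S.SigReg n ⊕ S.KeyReg n) Unit)
    (k₀ k₁ : BitStr (S.vkLen n) × BitStr (S.sigLen n)) :
    A.reflect.outProb (proj (ket (inputBits false k₀.2 k₀.1 k₁.1)))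
        (inputBits true k₁.2 k₀.1 k₁.1) ≤
      (forger A k₀).outProb (proj (ket k₁.1)) k₁.2 := by
  have hinput : Sum.elim k₁.1 (Sum.elim (Sum.elim (fun _ => false) k₀.2) k₀.1) ∘
      ((Equiv.sumComm _ _).trans (Equiv.sumAssoc (S.SigReg n) _ _)).symm =
        inputBits false k₀.2 k₀.1 k₁.1 := by
    ext ((_ | _) | (_ | _)) <;> rfl
  rw [forger, QMachine.outProb_hardwire, tensor_proj, tensorVec_ket, relabel_proj_ket, hinput]
  exact A.reflect.outProb_le_outProb_restrictOut (.trans .inr .inl) _ _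

theorem sq_interference_le_outProb_forger (A : QMachine (S.SigReg n ⊕ S.KeyReg n) Unit)
    (k₀ k₁ : BitStr (S.vkLen n) × BitStr (S.sigLen n)) :
    interference A k₀ k₁ ^ 2 ≤ (forger A k₀).outProb (proj (ket k₁.1)) k₁.2 := by
  have hne : inputBits false k₀.2 k₀.1 k₁.1 ≠ inputBits true k₁.2 k₀.1 k₁.1 := fun h =>
    Bool.false_ne_true (congrFun h (.inl (.inl ())))
  calc interference A k₀ k₁ ^ 2 ≤ (2 * interference A k₀ k₁) ^ 2 := by
        rw [mul_pow]
        exact le_mul_of_one_le_left (sq_nonneg _) (by norm_num)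
    _ ≤ _ := A.sq_two_mul_outProb_vecMulVec_le hne
    _ ≤ _ := outProb_reflect_le_outProb_forger A k₀ k₁

theorem exists_sq_advantage_le_keyOnlyForgeProb (hS : S.Correct)
    (bit : ∀ n, Bool ↪ BitStr (S.msgLen n)) (A : QMachine (S.SigReg n ⊕ S.KeyReg n) Unit) :
    ∃ k₀, (A.outProb (S.ensemble bit S.superposition n) (fun _ => true) -
        A.outProb (S.ensemble bit S.mixture n) (fun _ => true)) ^ 2 ≤
      S.keyOnlyForgeProb n (forger A k₀) (bit n true) := by
  obtain ⟨k₀, hk₀⟩ := exists_sum_toReal_mul_le (S.signed n (bit n false)) fun k₀ =>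
    (∑ k₁, (S.signed n (bit n true) k₁).toReal * interference A k₀ k₁) ^ 2
  refine ⟨k₀, ?_⟩
  rw [outProb_ensemble_superposition_sub_mixture]
  calc _ ≤ _ := sq_sum_toReal_mul_le _ _
    _ ≤ (∑ k₁, (S.signed n (bit n true) k₁).toReal * interference A k₀ k₁) ^ 2 := hk₀
    _ ≤ ∑ k₁, (S.signed n (bit n true) k₁).toReal * interference A k₀ k₁ ^ 2 :=
        sq_sum_toReal_mul_le _ _
    _ ≤ ∑ k₁, (S.signed n (bit n true) k₁).toReal *
          (forger A k₀).outProb (proj (ket k₁.1)) k₁.2 :=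
        Finset.sum_le_sum fun k₁ _ => mul_le_mul_of_nonneg_left
          (sq_interference_le_outProb_forger A k₀ k₁) ENNReal.toReal_nonneg
    _ ≤ S.keyOnlyForgeProb n (forger A k₀) (bit n true) :=
        sum_signed_mul_outProb_le_keyOnlyForgeProb hS _ _

theorem isQPT_forger {A : ∀ n, QMachine (S.SigReg n ⊕ S.KeyReg n) Unit}
    (hA : IsQPT (O := fun _ => Unit) A) (k₀ : ∀ n, BitStr (S.vkLen n) × BitStr (S.sigLen n)) :
    IsQPT fun n => forger (A n) (k₀ n) := by
  obtain ⟨q, hq⟩ := S.poly_len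
  refine hA.of_size_le 8 (q + 5) fun n => (size_forger_le (A n) (k₀ n)).trans ?_
  have hlen := hq n
  simp only [Polynomial.eval_add, Polynomial.eval_ofNat]
  omega

end OTS

end QOTS

theorem mainTheorem4_general (S : QOTS.OTS) (hcorrect : S.Correct)
    (bit : ∀ n, Bool ↪ QOTS.BitStr (S.msgLen n))
    (hunf : S.KeyOnlyUnforgeable fun n => bit n true) :
    QOTS.CompIndist (Q := fun n => S.SigReg n ⊕ S.KeyReg n)
      (S.ensemble bit S.superposition) (S.ensemble bit S.mixture) := by
  intro A hA
  choose k₀ hk₀ using fun n =>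
    QOTS.OTS.exists_sq_advantage_le_keyOnlyForgeProb hcorrect bit (A n)
  exact (hunf _ (QOTS.OTS.isQPT_forger hA k₀)).of_sq_le fun n => (sq_abs _).trans_le (hk₀ n)

theorem mainTheorem4 (S : QOTS.OTS) (hcorrect : S.Correct) (hunf : S.StronglyUnforgeable)
    (bit : ∀ n, Bool ↪ QOTS.BitStr (S.msgLen n)) :
    QOTS.CompIndist (Q := fun n => S.SigReg n ⊕ S.KeyReg n)
      (S.ensemble bit S.superposition) (S.ensemble bit S.mixture) :=
  mainTheorem4_general S hcorrect bit <|
    hunf.keyOnlyUnforgeable fun n => (bit n).injective.ne (by decide : true ≠ false)
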